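/- **Setting.** An $n$-vertex IFS on $\mathbb{R}$ consists of a finite directed graph with $n$ vertices (vertex set $V$, edge set $E^1$, each edge $e$ going from its initial vertex $i(e)$ to its terminal vertex $t(e)$; loops and multiple edges are allowed) together with, for each edge $e$, a contracting similarity $S_e:\mathbb{R}\to\mathbb{R}$ of ratio $r_e\in(0,1)$ that does not reflect (i.e. is increasing). Write $E_v^1$ for the set of edges leaving $v$. An attractor of the system is a family $(F_v)_{v\in V}$ of non-empty compact subsets of $\mathbb{R}$ with $$F_v=\bigcup_{e\in E_v^1}S_e(F_{t(e)})\qquad (v\in V).$$ A standard IFS is a $1$-vertex IFS, that is, a finite family of such similarities. A path is a non-empty finite string $e_1\cdots e_k$ of edges with $t(e_j)=i(e_{j+1})$ for $1\le j<k$; its vertex list is $i(e_1)\,t(e_1)\cdots t(e_k)$. A simple path is a path whose vertex list has $k+1$ different vertices. A simple cycle is a path with $i(e_1)=t(e_k)$ whose vertex list has exactly $k$ different vertices. It is attached to a vertex $v$ if $v$ occurs in its vertex list. **Theorem.** Let $n\ge 2$ and let an $n$-vertex IFS be given whose directed graph is strongly connected and has at least two edges leaving each vertex. Let $(F_v)_{v\in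 V}$ be its attractor and suppose that: * it is defined on the unit interval: $\{0,1\}\subset F_v\subset[0,1]$ for every $v\in V$; * the convex strong separation condition (CSSC) holds: $S_e(C(F_{t(e)}))\cap S_f(C(F_{t(f)}))=\emptyset$ for all $v\in V$ and all $e\ne f$ in $E_v^1$, where $C$ denotes the convex hull; * the number of edges is minimal: every IFS on $\mathbb{R}$ with the same vertex set $V$ and the same attractor $(F_v)_{v\in V}$ (on any finite directed graph with vertex set $V$, which need not be strongly connected, and with or without separation conditions) has at least $\#E^1$ edges. Let $u\in V$, let $s=\dim_{\mathrm H}F_u$, and suppose that the following conditions hold. 1. There are a vertex $w\neq u$ and a simple cycle $\mathbf{c}_w$ attached to $w$ but not to $u$. Let $\mathbf{p}$ be a simple path from $u$ to $w$, and let $V'$ be the set of all vertices in the vertex lists of $\mathbf{p}$ and $\mathbf{c}_w$. 2. $\mathcal{H}^s(F_u)=1$, and $\mathcal{H}^s(F_{t(e)})=1$ for every $v\in V'$ and every $e\in E_v^1$. 3. $F_u\not\subset F_v$ for every $v\in V'\setminus\{u\}$. Then $F_u$ is not the attractor of any standard IFS on $\mathbb{R}$, with or without separation conditions. -/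

import Mathlib

open MeasureTheory
open scoped NNReal ENNReal

universe u v

/-- A graph-directed iterated function system on `ℝ` with vertex set `V` and edge set `E`: each
edge `e` carries a contracting similarity `map e` of `ℝ` that does not reflect. The map of `e`
goes from the copy of `ℝ` at the terminal vertex `tgt e` to the copy at the initial vertex
`src e`. No condition is put on the directed graph here. -/
structure GraphIFS (V : Type u) (E : Type v) where
  src : E → V
  tgt : E → V
  map : E → ℝ → ℝ
  ratio : E → ℝ
  ratio_pos : ∀ e, 0 < ratio e
  ratio_lt_one : ∀ e, ratio e < 1
  dist_map : ∀ e x y, dist (map e x) (map e y) = ratio e * dist x y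
  strictMono_map : ∀ e, StrictMono (map e)

namespace GraphIFS

variable {V : Type u} {E : Type v}

/-- A finite directed path: a nonempty string of consecutive edges. -/
def IsPath (G : GraphIFS V E) (p : List E) : Prop :=
  p ≠ [] ∧ List.IsChain (fun e f => G.tgt e = G.src f) p

/-- The vertex list `i(e₁) t(e₁) t(e₂) ⋯ t(eₖ)` of `e₁ ⋯ eₖ`. -/
def vertexList (G : GraphIFS V E) : List E → List V
  | [] => []
  | e :: p => G.src e :: (e :: p).map G.tgt

/-- `p` is a path with initial vertex `a` and terminal vertex `b`. -/
def IsPathFromTo (G : GraphIFS V E) (p : List E) (a b : V) : Prop :=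
  G.IsPath p ∧ (G.vertexList p).head? = some a ∧ (G.vertexList p).getLast? = some b

/-- `p` is a simple path (and not a cycle) from `a` to `b`: no vertex is visited twice. -/
def IsSimplePathFromTo (G : GraphIFS V E) (p : List E) (a b : V) : Prop :=
  G.IsPathFromTo p a b ∧ (G.vertexList p).Nodup

/-- `c` is a simple cycle: its initial and terminal vertices agree, and apart from that no vertex
is visited twice. -/
def IsSimpleCycle (G : GraphIFS V E) (c : List E) : Prop :=
  (∃ a, G.IsPathFromTo c a a) ∧ (G.vertexList c).tail.Nodup

/-- Any vertex can be reached from any vertex along a directed path. -/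
def StronglyConnected (G : GraphIFS V E) : Prop :=
  ∀ a b : V, ∃ p, G.IsPathFromTo p a b

/-- Each vertex has at least two edges leaving it. -/
def TwoEdgesLeaving (G : GraphIFS V E) : Prop :=
  ∀ a : V, ∃ e f : E, e ≠ f ∧ G.src e = a ∧ G.src f = a

/-- `F` is the attractor: a list of nonempty compact sets satisfying the invariance equation
`F a = ⋃ S_e (F (t(e)))`, the union being over the edges `e` leaving `a`. -/
def IsAttractor (G : GraphIFS V E) (F : V → Set ℝ) : Prop :=
  (∀ a, (F a).Nonempty ∧ IsCompact (F a)) ∧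
    ∀ a, F a = ⋃ (e : E) (_ : G.src e = a), G.map e '' F (G.tgt e)

/-- The convex strong separation condition, for a system with attractor `F`. -/
def CSSC (G : GraphIFS V E) (F : V → Set ℝ) : Prop :=
  ∀ e f : E, e ≠ f → G.src e = G.src f →
    Disjoint (G.map e '' convexHull ℝ (F (G.tgt e))) (G.map f '' convexHull ℝ (F (G.tgt f)))

/-- The number of edges of `G` is minimal: every system with the same vertex set and the attractor
`F` has at least as many edges. -/
def HasMinimalEdges [Fintype E] (_G : GraphIFS V E) (F : V → Set ℝ) : Prop :=
  ∀ (E' : Type v) [Fintype E'] (H : GraphIFS V E'),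
    H.IsAttractor F → Fintype.card E ≤ Fintype.card E'

end GraphIFS

/-- A system with attractor `F` is defined on the unit interval. -/
def OnUnitInterval {V : Type u} (F : V → Set ℝ) : Prop :=
  ∀ a, {0, 1} ⊆ F a ∧ F a ⊆ Set.Icc 0 1

/-- `K` is the attractor of a standard IFS on `ℝ`, that is of a one-vertex system with finitely
many edges. No separation condition is imposed. -/
def IsStandardIFSAttractor (K : Set ℝ) : Prop :=
  ∃ (m : ℕ) (T : GraphIFS Unit (Fin m)), T.IsAttractor fun _ => K

/-!
Write `μ` for the `s`-dimensional Hausdorff measure, and call `S_e (F (tgt e))` the cell of the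
edge `e`. One has `0 < s < 1` because `F a` has at least two points and has gaps.

The central fact is the density bound `μ (F x ∩ I) ≤ |I| ^ s` for all vertices `x` and all compact
intervals `I` (`GraphIFS.StronglyConnected.hausdorffMeasure_inter_Icc_le`): if it failed, the
inefficient piece would recur at all places and all scales, and replacing it by its interval in
covers would lower the Hausdorff measure. As `μ (F a) = 1`, a contracted copy `T (F a) ⊆ F x`
attains the density bound, and it is therefore all of `F x ∩ T [0, 1]`. For `x ∈ V'` the cells
at `x` attain the bound too. By strict concavity of `t ↦ t ^ s`, two overlapping pieces that both attain it share
an endpoint (`left_eq_or_right_eq_of_overlap`). So a copy that meets two cells is a union of at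
least two whole cells, and replacing the edges of these cells by one edge to `a` with map `T` gives
a smaller system with the same attractor, against minimality. Hence `T [0, 1]` lies in the interval
of a single cell (`GraphIFS.HasMinimalEdges.exists_Icc_subset`).

Such a `T` can be pulled back by the map of that cell to a copy of `F a` in `F (tgt e)`, which is
again contracted if `tgt e ∈ V' \ {a}`, as `F a` is not a subset of `F (tgt e)`. Following `p` and
then the cycle `c` for ever stays in `V' \ {a}`, and each pull-back enlarges the ratio by a fixed
factor at least. So points of `F a` far down this path are only contained in copies of `F a` of
very small ratio (`GraphIFS.exists_isDeepPoint`), and no finite family of maps gives all of them.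
-/

/-! ### Similarities of the line and Hausdorff measure -/

/-- The increasing similarity `x ↦ r x + b` of the line. -/
def sim (r b x : ℝ) : ℝ := r * x + b

theorem sim_image_Icc {r : ℝ} (hr : 0 < r) (b : ℝ) :
    sim r b '' Set.Icc 0 1 = Set.Icc b (b + r) := by
  have : sim r b = fun x => r * x + b := rfl
  rw [this, Set.image_affine_Icc' hr]
  congr 1 <;> ring

theorem lipschitzWith_sim {r : ℝ} (hr : 0 < r) (b : ℝ) : LipschitzWith r.toNNReal (sim r b) := by
  refine LipschitzWith.of_dist_le_mul fun x y => ?_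
  rw [Real.coe_toNNReal _ hr.le, Real.dist_eq, Real.dist_eq, ← abs_of_pos hr, ← abs_mul,
    abs_of_pos hr]
  exact le_of_eq (by rw [sim, sim]; ring_nf)

theorem hausdorffMeasure_sim_image {r s : ℝ} (hr : 0 < r) (hs : 0 ≤ s) (b : ℝ) (A : Set ℝ) :
    μH[s] (sim r b '' A) = ENNReal.ofReal r ^ s * μH[s] A := by
  apply le_antisymm ((lipschitzWith_sim hr b).hausdorffMeasure_image_le hs A)
  have hinv : sim r⁻¹ (-(r⁻¹ * b)) '' (sim r b '' A) = A := by
    rw [Set.image_image]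
    conv_rhs => rw [← Set.image_id A]
    refine Set.image_congr fun x _ => ?_
    simp only [sim, id]
    field_simp
    ring
  have h := (lipschitzWith_sim (inv_pos.2 hr) (-(r⁻¹ * b))).hausdorffMeasure_image_le hs
    (sim r b '' A)
  rw [hinv] at h
  have h0 : ENNReal.ofReal r ≠ 0 := by simpa using hr
  calc ENNReal.ofReal r ^ s * μH[s] A
      ≤ ENNReal.ofReal r ^ s * (ENNReal.ofReal r⁻¹ ^ s * μH[s] (sim r b '' A)) := by
        gcongr; exact h
    _ = μH[s] (sim r b '' A) := by
        rw [← mul_assoc, ← ENNReal.mul_rpow_of_nonneg _ _ hs, ENNReal.ofReal_inv_of_pos hr,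
          ENNReal.mul_inv_cancel h0 ENNReal.ofReal_ne_top, ENNReal.one_rpow, one_mul]

/-! ### Hausdorff measure at a fixed scale -/

/-- The outer measure `H^s_δ`: the infimum of `∑ |U_i|^s` over the countable covers by sets of
diameter at most `δ`. -/
noncomputable def premeasure (s : ℝ) (δ : ℝ≥0∞) : OuterMeasure ℝ :=
  OuterMeasure.mkMetric'.pre (fun A => Metric.ediam A ^ s) δ

theorem premeasure_le_rpow (s : ℝ) {δ : ℝ≥0∞} {A : Set ℝ} (h : Metric.ediam A ≤ δ) :
    premeasure s δ A ≤ Metric.ediam A ^ s :=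
  OuterMeasure.mkMetric'.pre_le h

theorem premeasure_anti (s : ℝ) {δ ε : ℝ≥0∞} (h : δ ≤ ε) (A : Set ℝ) :
    premeasure s ε A ≤ premeasure s δ A :=
  OuterMeasure.mkMetric'.mono_pre _ h A

theorem coe_mkMetric'_rpow (s : ℝ) (A : Set ℝ) :
    OuterMeasure.mkMetric' (fun A : Set ℝ => Metric.ediam A ^ s) A = μH[s] A := by
  rw [Measure.hausdorffMeasure, ← OuterMeasure.coe_mkMetric]
  rfl

theorem tendsto_premeasure (s : ℝ) (A : Set ℝ) :
    Filter.Tendsto (fun δ => premeasure s δ A) (nhdsWithin 0 (Set.Ioi 0)) (nhds (μH[s] A)) := by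
  rw [← coe_mkMetric'_rpow]
  exact OuterMeasure.mkMetric'.tendsto_pre _ A

theorem premeasure_le_hausdorffMeasure (s : ℝ) {δ : ℝ≥0∞} (hδ : 0 < δ) (A : Set ℝ) :
    premeasure s δ A ≤ μH[s] A := by
  rw [← coe_mkMetric'_rpow]
  exact (le_iSup₂ (f := fun r (_ : r > 0) =>
    OuterMeasure.mkMetric'.pre (fun A : Set ℝ => Metric.ediam A ^ s) r) δ hδ) A

theorem premeasure_sim_image_le {r s : ℝ} (hr : 0 < r) (hs : 0 ≤ s) (b : ℝ) (δ : ℝ≥0∞)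
    (A : Set ℝ) :
    premeasure s (ENNReal.ofReal r * δ) (sim r b '' A) ≤
      ENNReal.ofReal r ^ s * premeasure s δ A := by
  have h0 : ENNReal.ofReal r ^ s ≠ 0 := by
    simp [ENNReal.rpow_eq_zero_iff, hr.not_ge]
  have ht : ENNReal.ofReal r ^ s ≠ ∞ := ENNReal.rpow_ne_top_of_nonneg hs ENNReal.ofReal_ne_top
  have key : (ENNReal.ofReal r ^ s)⁻¹ •
      OuterMeasure.comap (sim r b) (premeasure s (ENNReal.ofReal r * δ)) ≤ premeasure s δ := by
    refine OuterMeasure.mkMetric'.le_pre.2 fun B hB => ?_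
    have hd : Metric.ediam (sim r b '' B) ≤ ENNReal.ofReal r * Metric.ediam B :=
      (lipschitzWith_sim hr b).ediam_image_le B
    rw [smul_apply, OuterMeasure.comap_apply, smul_eq_mul]
    calc _ ≤ (ENNReal.ofReal r ^ s)⁻¹ * (ENNReal.ofReal r * Metric.ediam B) ^ s := by
          gcongr
          exact (premeasure_le_rpow s (hd.trans (by gcongr))).trans (by gcongr)
      _ = Metric.ediam B ^ s := by
          rw [ENNReal.mul_rpow_of_nonneg _ _ hs, ← mul_assoc, ENNReal.inv_mul_cancel h0 ht,
            one_mul]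
  have := key A
  rw [smul_apply, OuterMeasure.comap_apply, smul_eq_mul] at this
  calc _ = ENNReal.ofReal r ^ s * ((ENNReal.ofReal r ^ s)⁻¹ *
        premeasure s (ENNReal.ofReal r * δ) (sim r b '' A)) := by
        rw [← mul_assoc, ENNReal.mul_inv_cancel h0 ht, one_mul]
    _ ≤ _ := by gcongr

namespace GraphIFS

variable {V : Type u} {E : Type v} {G : GraphIFS V E} {F : V → Set ℝ}

/-! ### Cells of an attractor -/

theorem map_eq_sim (G : GraphIFS V E) (e : E) : G.map e = sim (G.ratio e) (G.map e 0) := by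
  funext x
  have h := G.dist_map e x 0
  rw [Real.dist_eq, Real.dist_eq, sub_zero] at h
  rcases le_total 0 x with hx | hx
  · rw [abs_of_nonneg (sub_nonneg.2 ((G.strictMono_map e).monotone hx)), abs_of_nonneg hx] at h
    simp only [sim]; linarith
  · rw [abs_of_nonpos (sub_nonpos.2 ((G.strictMono_map e).monotone hx)), abs_of_nonpos hx] at h
    simp only [sim]; linarith

theorem map_image_Icc (G : GraphIFS V E) (e : E) :
    G.map e '' Set.Icc 0 1 = Set.Icc (G.map e 0) (G.map e 0 + G.ratio e) := by
  rw [G.map_eq_sim e, sim_image_Icc (G.ratio_pos e)]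
  simp [sim]

theorem hausdorffMeasure_map_image (G : GraphIFS V E) {s : ℝ} (hs : 0 ≤ s) (e : E) (A : Set ℝ) :
    μH[s] (G.map e '' A) = ENNReal.ofReal (G.ratio e) ^ s * μH[s] A := by
  rw [G.map_eq_sim e, hausdorffMeasure_sim_image (G.ratio_pos e) hs]

theorem continuous_map (G : GraphIFS V E) (e : E) : Continuous (G.map e) := by
  rw [G.map_eq_sim e]
  exact (lipschitzWith_sim (G.ratio_pos e) _).continuous

theorem ofReal_ratio_rpow_ne_zero (G : GraphIFS V E) (s : ℝ) (e : E) :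
    ENNReal.ofReal (G.ratio e) ^ s ≠ 0 := by
  simp [ENNReal.rpow_eq_zero_iff, (G.ratio_pos e).not_ge]

theorem ofReal_ratio_rpow_ne_top (G : GraphIFS V E) {s : ℝ} (hs : 0 ≤ s) (e : E) :
    ENNReal.ofReal (G.ratio e) ^ s ≠ ∞ :=
  ENNReal.rpow_ne_top_of_nonneg hs ENNReal.ofReal_ne_top

theorem exists_ratio_le [Fintype E] (G : GraphIFS V E) :
    ∃ ρ : ℝ, 0 < ρ ∧ ρ < 1 ∧ ∀ e, G.ratio e ≤ ρ := by
  rcases isEmpty_or_nonempty E with h | h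
  · exact ⟨1 / 2, by norm_num, by norm_num, fun e => h.elim e⟩
  · obtain ⟨e, he⟩ := Finite.exists_max G.ratio
    exact ⟨G.ratio e, G.ratio_pos e, G.ratio_lt_one e, he⟩

theorem IsAttractor.cell_subset (hF : G.IsAttractor F) (e : E) :
    G.map e '' F (G.tgt e) ⊆ F (G.src e) := by
  rw [hF.2 (G.src e)]
  exact Set.subset_iUnion₂_of_subset e rfl subset_rfl

theorem IsAttractor.measurableSet (hF : G.IsAttractor F) (a : V) : MeasurableSet (F a) :=
  (hF.1 a).2.isClosed.measurableSet

theorem IsAttractor.measurableSet_cell (hF : G.IsAttractor F) (e : E) :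
    MeasurableSet (G.map e '' F (G.tgt e)) :=
  ((hF.1 _).2.image (G.continuous_map e)).isClosed.measurableSet

theorem IsAttractor.exists_mem_cell (hF : G.IsAttractor F) {a : V} {y : ℝ} (hy : y ∈ F a) :
    ∃ e, G.src e = a ∧ y ∈ G.map e '' F (G.tgt e) := by
  rw [hF.2 a] at hy
  simpa using hy

theorem cell_subset_image_Icc (hunit : OnUnitInterval F) (e : E) :
    G.map e '' F (G.tgt e) ⊆ G.map e '' Set.Icc 0 1 :=
  Set.image_mono (hunit _).2

theorem convexHull_eq_Icc (hunit : OnUnitInterval F) (a : V) :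
    convexHull ℝ (F a) = Set.Icc 0 1 := by
  apply (convexHull_min (hunit a).2 (convex_Icc 0 1)).antisymm
  rw [← segment_eq_Icc zero_le_one]
  exact (convex_convexHull ℝ _).segment_subset
    (subset_convexHull ℝ _ ((hunit a).1 (by simp))) (subset_convexHull ℝ _ ((hunit a).1 (by simp)))

theorem CSSC.disjoint_image_Icc (hcssc : G.CSSC F) (hunit : OnUnitInterval F) {e f : E}
    (hef : e ≠ f) (hsrc : G.src e = G.src f) :
    Disjoint (G.map e '' Set.Icc 0 1) (G.map f '' Set.Icc 0 1) := by
  simpa only [convexHull_eq_Icc hunit] using hcssc e f hef hsrc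

theorem CSSC.eq_of_mem (hcssc : G.CSSC F) (hunit : OnUnitInterval F) {e f : E} {y : ℝ}
    (hsrc : G.src e = G.src f) (he : y ∈ G.map e '' Set.Icc 0 1)
    (hf : y ∈ G.map f '' Set.Icc 0 1) : e = f := by
  by_contra hef
  exact Set.disjoint_left.1 (hcssc.disjoint_image_Icc hunit hef hsrc) he hf

open Classical in
theorem IsAttractor.hausdorffMeasure_eq_sum [Fintype E] (hF : G.IsAttractor F)
    (hunit : OnUnitInterval F) (hcssc : G.CSSC F) {s : ℝ} (hs : 0 ≤ s) (a : V) :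
    μH[s] (F a) = ∑ e ∈ Finset.univ.filter (fun e => G.src e = a),
      ENNReal.ofReal (G.ratio e) ^ s * μH[s] (F (G.tgt e)) := by
  have h : F a = ⋃ e ∈ Finset.univ.filter (fun e => G.src e = a), G.map e '' F (G.tgt e) := by
    rw [hF.2 a]; simp
  conv_lhs => rw [h]
  rw [measure_biUnion_finset _ fun e _ => hF.measurableSet_cell e]
  · simp_rw [G.hausdorffMeasure_map_image hs]
  · intro e he f hf hef
    simp only [Finset.coe_filter, Finset.mem_univ, true_and, Set.mem_ofPred_eq] at he hf
    exact (hcssc.disjoint_image_Icc hunit hef (he.trans hf.symm)).mono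
      (cell_subset_image_Icc hunit e) (cell_subset_image_Icc hunit f)

/-! ### Transport along paths -/

/-- A property that passes along edges passes along paths. -/
theorem IsPathFromTo.of_forall_edge (P : V → Prop) (hstep : ∀ e, P (G.src e) → P (G.tgt e)) :
    ∀ {p : List E} {a b : V}, G.IsPathFromTo p a b → P a → P b
  | [], a, b, h, _ => absurd rfl h.1.1
  | [e], a, b, h, ha => by
    obtain ⟨-, h1, h2⟩ := h
    simp only [vertexList, List.map_cons, List.map_nil, List.head?_cons, Option.some.injEq,
      List.getLast?_cons_cons, List.getLast?_singleton] at h1 h2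
    subst h1 h2
    exact hstep e ha
  | e :: f :: p, a, b, h, ha => by
    obtain ⟨⟨-, hc⟩, h1, h2⟩ := h
    rw [List.isChain_cons_cons] at hc
    simp only [vertexList, List.map_cons, List.head?_cons, Option.some.injEq] at h1
    refine IsPathFromTo.of_forall_edge P hstep (p := f :: p) (a := G.src f) (b := b)
      ⟨⟨by simp, hc.2⟩, by simp [vertexList], ?_⟩ ?_
    · simpa [vertexList, List.getLast?_cons_cons] using h2
    · rw [← hc.1]; subst h1; exact hstep e ha

theorem StronglyConnected.forall_of_tgt (hconn : G.StronglyConnected) (P : V → Prop) {a : V}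
    (ha : P a) (hstep : ∀ e, P (G.src e) → P (G.tgt e)) (b : V) : P b := by
  obtain ⟨p, hp⟩ := hconn a b
  exact hp.of_forall_edge P hstep ha

theorem StronglyConnected.forall_of_src (hconn : G.StronglyConnected) (P : V → Prop) {a : V}
    (ha : P a) (hstep : ∀ e, P (G.tgt e) → P (G.src e)) (b : V) : P b := by
  obtain ⟨p, hp⟩ := hconn b a
  by_contra hb
  exact hp.of_forall_edge (fun v => ¬ P v) (fun e h h' => h (hstep e h')) hb ha

theorem StronglyConnected.hausdorffMeasure_ne_top (hconn : G.StronglyConnected)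
    (hF : G.IsAttractor F) {s : ℝ} (hs : 0 ≤ s) {a : V} (ha : μH[s] (F a) ≠ ∞) (b : V) :
    μH[s] (F b) ≠ ∞ := by
  refine hconn.forall_of_tgt (fun v => μH[s] (F v) ≠ ∞) ha (fun e he ht => ?_) b
  have h := measure_mono (μ := μH[s]) (hF.cell_subset e)
  rw [G.hausdorffMeasure_map_image hs, ht, ENNReal.mul_top (G.ofReal_ratio_rpow_ne_zero s e)] at h
  exact he (top_le_iff.1 h)

theorem StronglyConnected.hausdorffMeasure_ne_zero (hconn : G.StronglyConnected)
    (hF : G.IsAttractor F) {s : ℝ} (hs : 0 ≤ s) {a : V} (ha : μH[s] (F a) ≠ 0) (b : V) :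
    μH[s] (F b) ≠ 0 := by
  refine hconn.forall_of_src (fun v => μH[s] (F v) ≠ 0) ha (fun e he ht => ?_) b
  have h := measure_mono_null (hF.cell_subset e) ht
  rw [G.hausdorffMeasure_map_image hs, mul_eq_zero] at h
  exact h.elim (G.ofReal_ratio_rpow_ne_zero s e) he

/-- Every relatively open piece of an attractor has positive measure. -/
theorem StronglyConnected.hausdorffMeasure_inter_Icc_ne_zero [Fintype E]
    (hconn : G.StronglyConnected) (hF : G.IsAttractor F) (hunit : OnUnitInterval F) {s : ℝ}
    (hs : 0 ≤ s) {a : V} (ha : μH[s] (F a) ≠ 0) {b : V} {y : ℝ} (hy : y ∈ F b) {ε : ℝ}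
    (hε : 0 < ε) : μH[s] (F b ∩ Set.Icc (y - ε) (y + ε)) ≠ 0 := by
  obtain ⟨ρ, hρ0, hρ1, hρ⟩ := G.exists_ratio_le
  have key : ∀ k : ℕ, ∀ b, ∀ y ∈ F b,
      μH[s] (F b ∩ Set.Icc (y - ρ ^ k) (y + ρ ^ k)) ≠ 0 := by
    intro k
    induction k with
    | zero =>
      intro b y hy
      have h1 := (hunit b).2 hy
      rw [Set.inter_eq_left.2 fun z hz => ?_]
      · exact hconn.hausdorffMeasure_ne_zero hF hs ha b
      · have h2 := (hunit b).2 hz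
        simp only [Set.mem_Icc, pow_zero] at h1 h2 ⊢
        constructor <;> linarith
    | succ k ih =>
      intro b y hy h0
      obtain ⟨e, rfl, x, hx, rfl⟩ := hF.exists_mem_cell hy
      have hsub : G.map e '' (F (G.tgt e) ∩ Set.Icc (x - ρ ^ k) (x + ρ ^ k)) ⊆
          F (G.src e) ∩ Set.Icc (G.map e x - ρ ^ (k + 1)) (G.map e x + ρ ^ (k + 1)) := by
        rintro _ ⟨z, ⟨hz, hz1, hz2⟩, rfl⟩
        refine ⟨hF.cell_subset e ⟨z, hz, rfl⟩, ?_⟩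
        have hd := G.dist_map e z x
        have hzx : dist z x ≤ ρ ^ k := by rw [Real.dist_eq, abs_le]; constructor <;> linarith
        have : dist (G.map e z) (G.map e x) ≤ ρ ^ (k + 1) := by
          rw [hd, pow_succ']
          exact mul_le_mul (hρ e) hzx dist_nonneg hρ0.le
        rw [Real.dist_eq, abs_le] at this
        constructor <;> linarith
      have h := measure_mono_null hsub h0
      rw [G.hausdorffMeasure_map_image hs, mul_eq_zero] at h
      exact h.elim (G.ofReal_ratio_rpow_ne_zero s e) (ih _ x hx)
  obtain ⟨k, hk⟩ := exists_pow_lt_of_lt_one hε hρ1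
  intro h0
  refine key k b y hy (measure_mono_null (Set.inter_subset_inter_right _ ?_) h0)
  exact Set.Icc_subset_Icc (by linarith) (by linarith)

/-! ### The density bound -/

/-- If covers of some positive scale undercut the Hausdorff measure at a vertex, then they do so
at every vertex: a cheap cover of `F (tgt e)` is carried by `S_e` to a part of `F (src e)`. -/
theorem StronglyConnected.exists_premeasure_lt (hconn : G.StronglyConnected)
    (hF : G.IsAttractor F) {s : ℝ} (hs : 0 ≤ s) (hfin : ∀ b, μH[s] (F b) ≠ ∞) {a : V} {δ : ℝ≥0∞}
    (hδ0 : 0 < δ) (hδ : δ ≠ ∞) (ha : premeasure s δ (F a) < μH[s] (F a)) (b : V) :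
    ∃ δ : ℝ≥0∞, 0 < δ ∧ δ ≠ ∞ ∧ premeasure s δ (F b) < μH[s] (F b) := by
  refine hconn.forall_of_src
    (fun b => ∃ δ : ℝ≥0∞, 0 < δ ∧ δ ≠ ∞ ∧ premeasure s δ (F b) < μH[s] (F b))
    ⟨δ, hδ0, hδ, ha⟩ ?_ b
  rintro e ⟨δ, hδ0, hδ, h⟩
  have hr : 0 < ENNReal.ofReal (G.ratio e) := by simpa using G.ratio_pos e
  have hδ' : 0 < ENNReal.ofReal (G.ratio e) * δ := ENNReal.mul_pos hr.ne' hδ0.ne'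
  refine ⟨_, hδ', ENNReal.mul_ne_top ENNReal.ofReal_ne_top hδ, ?_⟩
  set C := G.map e '' F (G.tgt e)
  have hC : premeasure s (ENNReal.ofReal (G.ratio e) * δ) C < μH[s] C := by
    refine lt_of_le_of_lt ?_ (lt_of_lt_of_eq ((ENNReal.mul_lt_mul_iff_right
      (G.ofReal_ratio_rpow_ne_zero s e) (G.ofReal_ratio_rpow_ne_top hs e)).2 h)
      (G.hausdorffMeasure_map_image hs e _).symm)
    have := premeasure_sim_image_le (G.ratio_pos e) hs (G.map e 0) δ (F (G.tgt e))
    rwa [← G.map_eq_sim e] at this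
  have hsub : C ⊆ F (G.src e) := hF.cell_subset e
  have hrest : μH[s] (F (G.src e) \ C) ≠ ∞ :=
    ne_top_of_le_ne_top (hfin _) (measure_mono Set.sdiff_subset)
  calc premeasure s (ENNReal.ofReal (G.ratio e) * δ) (F (G.src e))
      ≤ premeasure s (ENNReal.ofReal (G.ratio e) * δ) C +
        premeasure s (ENNReal.ofReal (G.ratio e) * δ) (F (G.src e) \ C) := by
        conv_lhs => rw [← Set.union_sdiff_cancel hsub]
        exact measure_union_le _ _
    _ ≤ premeasure s (ENNReal.ofReal (G.ratio e) * δ) C + μH[s] (F (G.src e) \ C) := by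
        gcongr; exact premeasure_le_hausdorffMeasure s hδ' _
    _ < μH[s] C + μH[s] (F (G.src e) \ C) := ENNReal.add_lt_add_right hrest hC
    _ = μH[s] (F (G.src e)) := by
        rw [measure_add_sdiff (hF.measurableSet_cell e).nullMeasurableSet,
          Set.union_eq_self_of_subset_left hsub]

/-- No scale `δ` allows cheaper covers than the Hausdorff measure. If one did, then at some scale `D`
the covers would be cheaper by a factor `θ < 1` at every vertex. Carrying them along the edges,
the same factor would be saved at arbitrarily small scales, hence in the limit. -/
theorem StronglyConnected.hausdorffMeasure_le_premeasure [Fintype V] [Fintype E]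
    (hconn : G.StronglyConnected) (hF : G.IsAttractor F) (hunit : OnUnitInterval F)
    (hcssc : G.CSSC F) {s : ℝ} (hs : 0 ≤ s) {a : V} (ha0 : μH[s] (F a) ≠ 0)
    (ha : μH[s] (F a) ≠ ∞) (b : V) {δ : ℝ≥0∞} (hδ0 : 0 < δ) (hδ : δ ≠ ∞) :
    μH[s] (F b) ≤ premeasure s δ (F b) := by
  classical
  by_contra! hlt
  have hfin := hconn.hausdorffMeasure_ne_top hF hs ha
  have hpos := hconn.hausdorffMeasure_ne_zero hF hs ha0
  choose δ' hδ'0 hδ' hlt' using hconn.exists_premeasure_lt hF hs hfin hδ0 hδ hlt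
  obtain ⟨ρ, hρ0, hρ1, hρ⟩ := G.exists_ratio_le
  obtain ⟨D, hD, hDv⟩ : ∃ D : ℝ≥0∞, D ≠ ∞ ∧ ∀ v, δ' v ≤ D :=
    ⟨∑ v, δ' v, by simpa using hδ',
      fun v => Finset.single_le_sum (fun _ _ => zero_le) (Finset.mem_univ v)⟩
  have hD0 : 0 < D := (hδ'0 a).trans_le (hDv a)
  set θ := Finset.univ.sup fun v => premeasure s D (F v) / μH[s] (F v)
  have hθ1 : θ < 1 := by
    refine (Finset.sup_lt_iff (by simp)).2 fun v _ => ?_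
    rw [ENNReal.div_lt_iff (Or.inl (hpos v)) (Or.inl (hfin v)), one_mul]
    exact (premeasure_anti s (hDv v) _).trans_lt (hlt' v)
  have hθ : ∀ v, premeasure s D (F v) ≤ θ * μH[s] (F v) := fun v => by
    rw [← ENNReal.div_le_iff (hpos v) (hfin v)]
    exact Finset.le_sup (f := fun v => premeasure s D (F v) / μH[s] (F v)) (Finset.mem_univ v)
  have iter : ∀ k : ℕ, ∀ v, premeasure s (ENNReal.ofReal ρ ^ k * D) (F v) ≤ θ * μH[s] (F v) := by
    intro k
    induction k with
    | zero => simpa using hθ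
    | succ k ih =>
      intro v
      have h : F v = ⋃ e ∈ Finset.univ.filter (fun e => G.src e = v), G.map e '' F (G.tgt e) := by
        rw [hF.2 v]; simp
      rw [hF.hausdorffMeasure_eq_sum hunit hcssc hs v, Finset.mul_sum]
      conv_lhs => rw [h]
      refine (measure_biUnion_finset_le _ _).trans (Finset.sum_le_sum fun e _ => ?_)
      have h1 := premeasure_sim_image_le (G.ratio_pos e) hs (G.map e 0)
        (ENNReal.ofReal ρ ^ k * D) (F (G.tgt e))
      rw [← G.map_eq_sim e] at h1
      refine (premeasure_anti s ?_ _).trans (h1.trans ?_)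
      · rw [pow_succ', mul_assoc]
        gcongr
        exact hρ e
      · calc _ ≤ ENNReal.ofReal (G.ratio e) ^ s * (θ * μH[s] (F (G.tgt e))) := by
              gcongr; exact ih _
          _ = _ := by ring
  have hlim : Filter.Tendsto (fun k : ℕ => ENNReal.ofReal ρ ^ k * D) Filter.atTop
      (nhdsWithin 0 (Set.Ioi 0)) := by
    refine tendsto_nhdsWithin_iff.2 ⟨?_, Filter.Eventually.of_forall fun k => ?_⟩
    · have := ENNReal.Tendsto.mul_const (b := D)
        (ENNReal.tendsto_pow_atTop_nhds_zero_of_lt_one (r := ENNReal.ofReal ρ)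
          (by simpa using hρ1)) (Or.inr hD)
      simpa using this
    · exact ENNReal.mul_pos (pow_ne_zero _ (by simpa using hρ0)) hD0.ne'
  have hle : μH[s] (F a) ≤ θ * μH[s] (F a) :=
    le_of_tendsto ((tendsto_premeasure s (F a)).comp hlim)
      (Filter.Eventually.of_forall fun k => iter k a)
  have : θ * μH[s] (F a) < 1 * μH[s] (F a) :=
    (ENNReal.mul_lt_mul_iff_left ha0 ha).2 hθ1
  rw [one_mul] at this
  exact absurd hle this.not_ge

/-- The density bound: an interval contains at most the mass `|I|^s` of `F b`, since otherwise
covering this part by `I` alone would be too cheap. -/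
theorem StronglyConnected.hausdorffMeasure_inter_Icc_le [Fintype V] [Fintype E]
    (hconn : G.StronglyConnected) (hF : G.IsAttractor F) (hunit : OnUnitInterval F)
    (hcssc : G.CSSC F) {s : ℝ} (hs : 0 < s) {a : V} (ha0 : μH[s] (F a) ≠ 0)
    (ha : μH[s] (F a) ≠ ∞) (b : V) {c d : ℝ} (hcd : c ≤ d) :
    μH[s] (F b ∩ Set.Icc c d) ≤ ENNReal.ofReal (d - c) ^ s := by
  rcases hcd.eq_or_lt with rfl | hcd
  · have := Measure.nullSingletonClass_hausdorff ℝ hs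
    refine (measure_mono_null Set.inter_subset_right ?_).trans_le zero_le
    simp
  have hdiam : Metric.ediam (F b ∩ Set.Icc c d) ≤ ENNReal.ofReal (d - c) :=
    (Metric.ediam_mono Set.inter_subset_right).trans_eq (Real.ediam_Icc c d)
  have hδ : 0 < ENNReal.ofReal (d - c) := by simpa using hcd
  have hfin := hconn.hausdorffMeasure_ne_top hF hs.le ha b
  have h := hconn.hausdorffMeasure_le_premeasure hF hunit hcssc hs.le ha0 ha b hδ
    ENNReal.ofReal_ne_top
  have hrest : μH[s] (F b \ Set.Icc c d) ≠ ∞ :=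
    ne_top_of_le_ne_top hfin (measure_mono Set.sdiff_subset)
  refine (ENNReal.add_le_add_iff_right hrest).1 ?_
  calc μH[s] (F b ∩ Set.Icc c d) + μH[s] (F b \ Set.Icc c d)
      = μH[s] (F b) := measure_inter_add_sdiff _ measurableSet_Icc
    _ ≤ premeasure s (ENNReal.ofReal (d - c)) (F b) := h
    _ ≤ premeasure s (ENNReal.ofReal (d - c)) (F b ∩ Set.Icc c d) +
        premeasure s (ENNReal.ofReal (d - c)) (F b \ Set.Icc c d) := by
        conv_lhs => rw [← Set.inter_union_sdiff (F b) (Set.Icc c d)]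
        exact measure_union_le _ _
    _ ≤ ENNReal.ofReal (d - c) ^ s + μH[s] (F b \ Set.Icc c d) := by
        gcongr
        · exact (premeasure_le_rpow s hdiam).trans (by gcongr)
        · exact premeasure_le_hausdorffMeasure s hδ _

end GraphIFS

/-! ### Overlapping intervals of maximal density -/

/-- Strict concavity of `t ↦ t ^ s`, in the form used for two overlapping intervals
`[l, g]` and `[c, d]` with union `[l, d]` and intersection `[c, g]`. -/
theorem rpow_add_rpow_lt_of_overlap {s l c g d : ℝ} (hs0 : 0 < s) (hs1 : s < 1)
    (hlc : l < c) (hcg : c ≤ g) (hgd : g < d) :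
    (d - l) ^ s + (g - c) ^ s < (g - l) ^ s + (d - c) ^ s := by
  have hN : 0 < (d - l) - (g - c) := by linarith
  have hp : 0 < (c - l) / ((d - l) - (g - c)) := div_pos (by linarith) hN
  have hq : 0 < (d - g) / ((d - l) - (g - c)) := div_pos (by linarith) hN
  have hpq : (c - l) / ((d - l) - (g - c)) + (d - g) / ((d - l) - (g - c)) = 1 := by
    field_simp; ring
  have hne : (g - c) ≠ (d - l) := by linarith
  have hx : (g - c) ∈ Set.Ici (0 : ℝ) := by simpa using hcg
  have hy : (d - l) ∈ Set.Ici (0 : ℝ) := by simp; linarith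
  have h1 := (Real.strictConcaveOn_rpow hs0 hs1).2 hx hy hne hp hq hpq
  have h2 := (Real.strictConcaveOn_rpow hs0 hs1).2 hx hy hne hq hp (by rw [add_comm]; exact hpq)
  simp only [smul_eq_mul] at h1 h2
  have e1 : (c - l) / ((d - l) - (g - c)) * (g - c) + (d - g) / ((d - l) - (g - c)) * (d - l)
      = d - c := by field_simp; ring
  have e2 : (d - g) / ((d - l) - (g - c)) * (g - c) + (c - l) / ((d - l) - (g - c)) * (d - l)
      = g - l := by field_simp; ring
  rw [e1] at h1
  rw [e2] at h2
  have e3 : ∀ x : ℝ, (c - l) / ((d - l) - (g - c)) * x + (d - g) / ((d - l) - (g - c)) * x = x :=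
    fun x => by rw [← add_mul, hpq, one_mul]
  have := e3 ((g - c) ^ s)
  have := e3 ((d - l) ^ s)
  linarith

/-- For a set `K` satisfying the density bound, two pieces of `K` of maximal density whose
intervals `[l, g]` and `[c, d]` overlap have a common left or a common right end. -/
theorem left_eq_or_right_eq_of_overlap {K A B : Set ℝ} {s l c g d : ℝ} (hs0 : 0 < s) (hs1 : s < 1)
    (hK : ∀ c d, c ≤ d → μH[s] (K ∩ Set.Icc c d) ≤ ENNReal.ofReal (d - c) ^ s)
    (hBm : MeasurableSet B) (hA : A ⊆ K ∩ Set.Icc l g) (hB : B ⊆ K ∩ Set.Icc c d)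
    (hlc : l ≤ c) (hcg : c ≤ g) (hgd : g ≤ d)
    (hμA : ENNReal.ofReal (g - l) ^ s ≤ μH[s] A) (hμB : ENNReal.ofReal (d - c) ^ s ≤ μH[s] B) :
    l = c ∨ g = d := by
  by_contra! hne
  have hlt := rpow_add_rpow_lt_of_overlap hs0 hs1 (lt_of_le_of_ne hlc hne.1) hcg
    (lt_of_le_of_ne hgd hne.2)
  have hunion : μH[s] (A ∪ B) ≤ ENNReal.ofReal (d - l) ^ s := by
    refine (measure_mono ?_).trans (hK l d (by linarith))
    rintro y (hy | hy)
    · exact ⟨(hA hy).1, (hA hy).2.1, (hA hy).2.2.trans hgd⟩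
    · exact ⟨(hB hy).1, hlc.trans (hB hy).2.1, (hB hy).2.2⟩
  have hinter : μH[s] (A ∩ B) ≤ ENNReal.ofReal (g - c) ^ s := by
    refine (measure_mono ?_).trans (hK c g hcg)
    exact fun y hy => ⟨(hA hy.1).1, (hB hy.2).2.1, (hA hy.1).2.2⟩
  have hle : ENNReal.ofReal (g - l) ^ s + ENNReal.ofReal (d - c) ^ s ≤
      ENNReal.ofReal (d - l) ^ s + ENNReal.ofReal (g - c) ^ s :=
    calc _ ≤ μH[s] A + μH[s] B := add_le_add hμA hμB
      _ = μH[s] (A ∪ B) + μH[s] (A ∩ B) := (measure_union_add_inter A hBm).symm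
      _ ≤ _ := add_le_add hunion hinter
  have h1 : 0 ≤ g - l := by linarith
  have h2 : 0 ≤ d - c := by linarith
  have h3 : 0 ≤ d - l := by linarith
  have h4 : 0 ≤ g - c := by linarith
  rw [ENNReal.ofReal_rpow_of_nonneg h1 hs0.le, ENNReal.ofReal_rpow_of_nonneg h2 hs0.le,
    ENNReal.ofReal_rpow_of_nonneg h3 hs0.le, ENNReal.ofReal_rpow_of_nonneg h4 hs0.le,
    ← ENNReal.ofReal_add (by positivity) (by positivity),
    ← ENNReal.ofReal_add (by positivity) (by positivity),
    ENNReal.ofReal_le_ofReal_iff (by positivity)] at hle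
  exact hlt.not_ge hle

namespace GraphIFS

variable {V : Type u} {E : Type v} {G : GraphIFS V E} {F : V → Set ℝ}

/-! ### Copies of the attractor and minimality -/

/-- The system obtained from `G` by deleting the edges in `B` and adding one edge from `x` to `a`
that carries the similarity `y ↦ t y + b`. -/
def mergeEdges (G : GraphIFS V E) (B : Set E) (x a : V) (t b : ℝ) (ht0 : 0 < t) (ht1 : t < 1) :
    GraphIFS V (Option {g : E // g ∉ B}) where
  src := fun o => o.elim x fun g => G.src g
  tgt := fun o => o.elim a fun g => G.tgt g
  map := fun o => o.elim (sim t b) fun g => G.map g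
  ratio := fun o => o.elim t fun g => G.ratio g
  ratio_pos := by rintro (_ | g); exacts [ht0, G.ratio_pos g]
  ratio_lt_one := by rintro (_ | g); exacts [ht1, G.ratio_lt_one g]
  dist_map := by
    rintro (_ | g) y z
    · simp only [Option.elim, sim, dist_add_right, Real.dist_eq, ← mul_sub, abs_mul,
        abs_of_pos ht0]
    · exact G.dist_map g y z
  strictMono_map := by
    rintro (_ | g)
    · intro y z hyz
      simp only [Option.elim, sim]
      gcongr
    · exact G.strictMono_map g

/-- If the number of edges is minimal, then at least two cells at a vertex never make up a single
similar copy of a component of the attractor. -/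
theorem HasMinimalEdges.image_ne_biUnion [Fintype E] (hmin : G.HasMinimalEdges F)
    (hF : G.IsAttractor F) {B : Set E} {x a : V} (hB : ∀ g ∈ B, G.src g = x) {e f : E}
    (he : e ∈ B) (hf : f ∈ B) (hef : e ≠ f) {t : ℝ} (ht0 : 0 < t) (ht1 : t < 1) (b : ℝ) :
    sim t b '' F a ≠ ⋃ g ∈ B, G.map g '' F (G.tgt g) := by
  classical
  intro h
  have hatt : (G.mergeEdges B x a t b ht0 ht1).IsAttractor F := by
    refine ⟨hF.1, fun v => ?_⟩
    ext y
    simp only [Set.mem_iUnion, exists_prop]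
    constructor
    · intro hy
      obtain ⟨g, rfl, hg⟩ := hF.exists_mem_cell hy
      by_cases hgB : g ∈ B
      · refine ⟨none, (hB g hgB).symm, ?_⟩
        change y ∈ sim t b '' F a
        rw [h]
        exact Set.mem_biUnion hgB hg
      · exact ⟨some ⟨g, hgB⟩, rfl, hg⟩
    · rintro ⟨_ | g, hsrc, hy⟩
      · change x = v at hsrc
        change y ∈ sim t b '' F a at hy
        rw [h] at hy
        simp only [Set.mem_iUnion, exists_prop] at hy
        obtain ⟨g, hgB, hg⟩ := hy
        rw [← hsrc, ← hB g hgB]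
        exact hF.cell_subset g hg
      · change G.src g = v at hsrc
        rw [← hsrc]
        exact hF.cell_subset _ hy
  have hcard := hmin _ _ hatt
  rw [Fintype.card_option, Fintype.card_subtype_compl] at hcard
  have h2 : 1 < Fintype.card {g // g ∈ B} :=
    Fintype.one_lt_card_iff.2 ⟨⟨e, he⟩, ⟨f, hf⟩, by simpa using hef⟩
  have h3 : Fintype.card {g // g ∈ B} ≤ Fintype.card E := Fintype.card_subtype_le _
  omega

/-- A copy of `F a` inside `F x` that attains the density bound is all of `F x` in its interval:
what is left over is relatively open and null. -/
theorem StronglyConnected.inter_Icc_eq_image [Fintype E] (hconn : G.StronglyConnected)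
    (hF : G.IsAttractor F) (hunit : OnUnitInterval F) {s : ℝ} (hs : 0 ≤ s) {a x : V}
    (ha : μH[s] (F a) = 1) {t b : ℝ} (ht : 0 < t)
    (hx : μH[s] (F x ∩ Set.Icc b (b + t)) ≤ ENNReal.ofReal t ^ s)
    (hT : sim t b '' F a ⊆ F x) : F x ∩ Set.Icc b (b + t) = sim t b '' F a := by
  have hTI : sim t b '' F a ⊆ Set.Icc b (b + t) :=
    (Set.image_mono (hunit a).2).trans (sim_image_Icc ht b).subset
  refine Set.Subset.antisymm ?_ (Set.subset_inter hT hTI)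
  rintro y ⟨hyF, hyb, hyt⟩
  by_contra hy
  have hTc : IsClosed (sim t b '' F a) :=
    ((hF.1 a).2.image (lipschitzWith_sim ht b).continuous).isClosed
  have hby : b < y := by
    refine lt_of_le_of_ne hyb fun h => hy ⟨0, (hunit a).1 (by simp), ?_⟩
    simp [sim, h]
  have hyd : y < b + t := by
    refine lt_of_le_of_ne hyt fun h => hy ⟨1, (hunit a).1 (by simp), ?_⟩
    simp [sim, h, add_comm]
  have hopen : IsOpen ((sim t b '' F a)ᶜ ∩ Set.Ioo b (b + t)) := hTc.isOpen_compl.inter isOpen_Ioo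
  obtain ⟨ε, hε, hball⟩ := Metric.isOpen_iff.1 hopen y ⟨hy, hby, hyd⟩
  have hμT : μH[s] (sim t b '' F a) = ENNReal.ofReal t ^ s := by
    rw [hausdorffMeasure_sim_image ht hs, ha, mul_one]
  have hball' : Set.Icc (y - ε / 2) (y + ε / 2) ⊆ (sim t b '' F a)ᶜ ∩ Set.Ioo b (b + t) := by
    rw [← Real.closedBall_eq_Icc]
    exact (Metric.closedBall_subset_ball (by linarith)).trans hball
  have hpos := hconn.hausdorffMeasure_inter_Icc_ne_zero hF hunit hs (by rw [ha]; simp) hyF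
    (half_pos hε)
  have hdisj : Disjoint (sim t b '' F a) (F x ∩ Set.Icc (y - ε / 2) (y + ε / 2)) :=
    Set.disjoint_left.2 fun z hz hz' => (hball' hz'.2).1 hz
  have hle : ENNReal.ofReal t ^ s + μH[s] (F x ∩ Set.Icc (y - ε / 2) (y + ε / 2)) ≤
      ENNReal.ofReal t ^ s := by
    rw [← hμT, ← measure_union hdisj ((hF.measurableSet x).inter measurableSet_Icc), hμT]
    refine (measure_mono (Set.union_subset (Set.subset_inter hT hTI) ?_)).trans hx
    exact fun z hz => ⟨hz.1, Set.Ioo_subset_Icc_self (hball' hz.2).2⟩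
  have hfin : ENNReal.ofReal t ^ s ≠ ∞ := ENNReal.rpow_ne_top_of_nonneg hs ENNReal.ofReal_ne_top
  exact hpos (by simpa using (ENNReal.add_le_add_iff_left hfin).1 (hle.trans (add_zero _).ge))

/-- A contracted copy of `F a` inside `F x` lies in the interval of a single cell. Otherwise,
as both the copy and the cells attain the density bound, the copy is made up of whole cells. -/
theorem HasMinimalEdges.exists_Icc_subset [Fintype V] [Fintype E] (hmin : G.HasMinimalEdges F)
    (hconn : G.StronglyConnected) (hF : G.IsAttractor F) (hunit : OnUnitInterval F)
    (hcssc : G.CSSC F) {s : ℝ} (hs0 : 0 < s) (hs1 : s < 1) {a x : V} (ha : μH[s] (F a) = 1)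
    (hx : ∀ e, G.src e = x → μH[s] (F (G.tgt e)) = 1) {t b : ℝ} (ht0 : 0 < t) (ht1 : t < 1)
    (hT : sim t b '' F a ⊆ F x) :
    ∃ e, G.src e = x ∧ Set.Icc b (b + t) ⊆ G.map e '' Set.Icc 0 1 := by
  have hK : ∀ c d, c ≤ d → μH[s] (F x ∩ Set.Icc c d) ≤ ENNReal.ofReal (d - c) ^ s :=
    fun c d => hconn.hausdorffMeasure_inter_Icc_le hF hunit hcssc hs0 (a := a) (by simp [ha])
      (by simp [ha]) x
  have heq : F x ∩ Set.Icc b (b + t) = sim t b '' F a :=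
    hconn.inter_Icc_eq_image hF hunit hs0.le ha ht0
      (by simpa using hK b (b + t) (by linarith)) hT
  have hμT : ENNReal.ofReal t ^ s = μH[s] (sim t b '' F a) := by
    rw [hausdorffMeasure_sim_image ht0 hs0.le, ha, mul_one]
  have hcell : ∀ e, G.src e = x → ENNReal.ofReal (G.ratio e) ^ s =
      μH[s] (G.map e '' F (G.tgt e)) := fun e he => by
    rw [G.hausdorffMeasure_map_image hs0.le, hx e he, mul_one]
  have hcellsub : ∀ e, G.src e = x → G.map e '' F (G.tgt e) ⊆
      F x ∩ Set.Icc (G.map e 0) (G.map e 0 + G.ratio e) := fun e he => by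
    subst he
    rw [← G.map_image_Icc e]
    exact Set.subset_inter (hF.cell_subset e) (cell_subset_image_Icc hunit e)
  have hTm : MeasurableSet (sim t b '' F a) := by
    rw [← heq]; exact (hF.measurableSet x).inter measurableSet_Icc
  have hb : b ∈ F x := hT ⟨0, (hunit a).1 (by simp), by simp [sim]⟩
  have hbt : b + t ∈ F x := hT ⟨1, (hunit a).1 (by simp), by simp [sim, add_comm]⟩
  obtain ⟨e, rfl, he⟩ := hF.exists_mem_cell hb
  obtain ⟨f, hfe, hf⟩ := hF.exists_mem_cell hbt
  have he' := cell_subset_image_Icc hunit e he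
  have hf' := cell_subset_image_Icc hunit f hf
  by_cases hef : e = f
  · subst hef
    refine ⟨e, rfl, ?_⟩
    rw [G.map_image_Icc] at he' hf' ⊢
    exact Set.Icc_subset_Icc he'.1 hf'.2
  exfalso
  have hdisj : ∀ y, y ∈ G.map e '' Set.Icc 0 1 → y ∉ G.map f '' Set.Icc 0 1 := fun y h1 h2 =>
    hef (hcssc.eq_of_mem hunit hfe.symm h1 h2)
  rw [G.map_image_Icc] at he' hf'
  rw [G.map_image_Icc, G.map_image_Icc] at hdisj
  have hre := G.ratio_pos e
  have hrf := G.ratio_pos f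
  have hge : G.map e 0 + G.ratio e < b + t := by
    by_contra! h
    exact hdisj (b + t) ⟨by linarith [he'.1], h⟩ hf'
  have hlf : b < G.map f 0 := by
    by_contra! h
    exact hdisj b he' ⟨h, by linarith [hf'.2]⟩
  -- The cell of `e` reaches from the left into `[b, b + t]` and ends inside it, so concavity
  -- forces it to start at `b`; the cell of `f` is treated in the same way on the right.
  have hleft : G.map e 0 = b := by
    refine (left_eq_or_right_eq_of_overlap hs0 hs1 hK hTm (hcellsub e rfl) heq.ge he'.1 he'.2
      hge.le ?_ ?_).resolve_right hge.ne
    · simpa using (hcell e rfl).le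
    · simpa using hμT.le
  have hright : b + t = G.map f 0 + G.ratio f := by
    refine (left_eq_or_right_eq_of_overlap hs0 hs1 hK (hF.measurableSet_cell f) heq.ge
      (hcellsub f hfe) hlf.le hf'.1 hf'.2 ?_ ?_).resolve_left hlf.ne
    · simpa using hμT.le
    · simpa using (hcell f hfe).le
  -- Hence the copy is the union of the cells inside `[b, b + t]`, those of `e` and `f` among them.
  set B : Set E := {g | G.src g = G.src e ∧ G.map g '' Set.Icc 0 1 ⊆ Set.Icc b (b + t)}
  refine hmin.image_ne_biUnion hF (B := B) (x := G.src e) (a := a) (fun g hg => hg.1)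
    (e := e) (f := f) ⟨rfl, ?_⟩ ⟨hfe, ?_⟩ hef ht0 ht1 b ?_
  · rw [G.map_image_Icc]; exact Set.Icc_subset_Icc hleft.ge hge.le
  · rw [G.map_image_Icc]; exact Set.Icc_subset_Icc hlf.le hright.ge
  · rw [← heq]
    ext y
    simp only [Set.mem_iUnion, exists_prop]
    constructor
    · rintro ⟨hyF, hyb⟩
      obtain ⟨g, hge', hg⟩ := hF.exists_mem_cell hyF
      refine ⟨g, ⟨hge', ?_⟩, hg⟩
      have hgI := cell_subset_image_Icc hunit g hg
      by_cases hgE : g = e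
      · subst hgE; rw [G.map_image_Icc]; exact Set.Icc_subset_Icc hleft.ge hge.le
      by_cases hgF : g = f
      · subst hgF; rw [G.map_image_Icc]; exact Set.Icc_subset_Icc hlf.le hright.ge
      have h1 : b ∉ G.map g '' Set.Icc 0 1 := fun h =>
        hgE (hcssc.eq_of_mem hunit hge' h (cell_subset_image_Icc hunit e he))
      have h2 : b + t ∉ G.map g '' Set.Icc 0 1 := fun h =>
        hgF (hcssc.eq_of_mem hunit (hge'.trans hfe.symm) h (cell_subset_image_Icc hunit f hf))
      rw [G.map_image_Icc] at hgI h1 h2 ⊢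
      refine Set.Icc_subset_Icc ?_ ?_
      · by_contra! h
        exact h1 ⟨h.le, hyb.1.trans hgI.2⟩
      · by_contra! h
        exact h2 ⟨hgI.1.trans hyb.2, h.le⟩
    · rintro ⟨g, ⟨hge', hgI⟩, hg⟩
      refine ⟨hge' ▸ hF.cell_subset g hg, hgI (cell_subset_image_Icc hunit g hg)⟩

/-! ### Points that are reached by small copies only -/

/-- `z` is a point of `F x`, and every contracted copy of `F a` that lies in `F x` and contains `z`
has ratio at most `M`. Copies of ratio at least `1` are not considered. -/
def IsDeepPoint (F : V → Set ℝ) (a x : V) (M z : ℝ) : Prop :=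
  z ∈ F x ∧ ∀ t b : ℝ, 0 < t → t < 1 → z ∈ sim t b '' F a → sim t b '' F a ⊆ F x → t ≤ M

/-- A copy of `F a` that reaches `S_e z` lies in the cell of `e`, and pulling it back by `S_e`
gives a copy of `F a` that reaches `z`; the pulled back copy is still contracted, as
`F a ⊄ F (tgt e)`. -/
theorem IsDeepPoint.map (hF : G.IsAttractor F) (hunit : OnUnitInterval F) (hcssc : G.CSSC F)
    {a : V} {e : E}
    (hcell : ∀ t b : ℝ, 0 < t → t < 1 → sim t b '' F a ⊆ F (G.src e) →
      ∃ g, G.src g = G.src e ∧ Set.Icc b (b + t) ⊆ G.map g '' Set.Icc 0 1)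
    (hsub : ¬ F a ⊆ F (G.tgt e)) {M z : ℝ} (hz : IsDeepPoint F a (G.tgt e) M z) :
    IsDeepPoint F a (G.src e) (G.ratio e * M) (G.map e z) := by
  refine ⟨hF.cell_subset e ⟨z, hz.1, rfl⟩, ?_⟩
  rintro t b ht0 ht1 ⟨w, hw, hwz⟩ hT
  have hr := G.ratio_pos e
  obtain ⟨g, hge, hg⟩ := hcell t b ht0 ht1 hT
  have hTI : sim t b '' F a ⊆ Set.Icc b (b + t) :=
    (Set.image_mono (hunit a).2).trans (sim_image_Icc ht0 b).subset
  obtain rfl : g = e := by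
    refine hcssc.eq_of_mem hunit hge (hg (hTI ⟨w, hw, rfl⟩)) ?_
    rw [hwz]
    exact ⟨z, (hunit _).2 hz.1, rfl⟩
  have hcomp : ∀ y, G.map g (sim (t / G.ratio g) ((b - G.map g 0) / G.ratio g) y) =
      sim t b y := fun y => by
    rw [G.map_eq_sim g]
    simp only [sim]
    field_simp
    ring
  have hinj := (G.strictMono_map g).injective
  have hT' : sim (t / G.ratio g) ((b - G.map g 0) / G.ratio g) '' F a ⊆ F (G.tgt g) := by
    rintro _ ⟨y, hy, rfl⟩
    have hyT : sim t b y ∈ sim t b '' F a := ⟨y, hy, rfl⟩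
    obtain ⟨h, hhg, hh⟩ := hF.exists_mem_cell (hT hyT)
    obtain rfl : h = g :=
      hcssc.eq_of_mem hunit hhg (cell_subset_image_Icc hunit h hh) (hg (hTI hyT))
    obtain ⟨q, hq, hq'⟩ := hh
    rw [← hcomp y] at hq'
    rwa [← hinj hq']
  rw [G.map_image_Icc, Set.Icc_subset_Icc_iff (by linarith)] at hg
  have hle : t ≤ G.ratio g := by linarith [hg.1, hg.2]
  have hne : t ≠ G.ratio g := by
    -- With equal ratios the pulled back copy would be `F a` itself.
    rintro rfl
    have hb : b - G.map g 0 = 0 := by linarith [hg.1, hg.2]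
    rw [hb, div_self hr.ne', zero_div] at hT'
    refine hsub fun y hy => hT' ⟨y, hy, by simp [sim]⟩
  have hlt : t / G.ratio g < 1 := (div_lt_one hr).2 (lt_of_le_of_ne hle hne)
  have := hz.2 _ _ (div_pos ht0 hr) hlt ⟨w, hw, hinj (by rw [hcomp, hwz])⟩ hT'
  rwa [div_le_iff₀ hr, mul_comm] at this

/-- Along an infinite path that stays in `W`, the admissible ratios shrink to zero. -/
theorem exists_isDeepPoint [Fintype E] (hF : G.IsAttractor F) (hunit : OnUnitInterval F)
    (hcssc : G.CSSC F) {a : V} {W : Set V} (hW : ∀ x ∈ W, ∃ e, G.src e = x ∧ G.tgt e ∈ W)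
    (hcell : ∀ x ∈ W, ∀ t b : ℝ, 0 < t → t < 1 → sim t b '' F a ⊆ F x →
      ∃ g, G.src g = x ∧ Set.Icc b (b + t) ⊆ G.map g '' Set.Icc 0 1)
    (hsub : ∀ x ∈ W, ¬ F a ⊆ F x) {ε : ℝ} (hε : 0 < ε) {x : V} (hx : x ∈ W) :
    ∃ z, IsDeepPoint F a x ε z := by
  obtain ⟨ρ, hρ0, hρ1, hρ⟩ := G.exists_ratio_le
  have key : ∀ k : ℕ, ∀ x ∈ W, ∃ z, IsDeepPoint F a x (ρ ^ k) z := by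
    intro k
    induction k with
    | zero =>
      intro x _
      exact ⟨0, (hunit x).1 (by simp), fun t b _ ht _ _ => by simpa using ht.le⟩
    | succ k ih =>
      intro x hx
      obtain ⟨e, rfl, he⟩ := hW x hx
      obtain ⟨z, hz⟩ := ih _ he
      have h := hz.map hF hunit hcssc (hcell _ hx) (hsub _ he)
      refine ⟨_, h.1, fun t b h0 h1 h2 h3 => (h.2 t b h0 h1 h2 h3).trans ?_⟩
      rw [pow_succ']
      gcongr
      exact hρ e
  obtain ⟨k, hk⟩ := exists_pow_lt_of_lt_one hε hρ1
  obtain ⟨z, hz⟩ := key k x hx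
  exact ⟨z, hz.1, fun t b h0 h1 h2 h3 => (hz.2 t b h0 h1 h2 h3).trans hk.le⟩

/-- The finitely many maps of a standard system have a smallest ratio, which a point that is only
reached by smaller copies contradicts. -/
theorem not_isStandardIFSAttractor_of_isDeepPoint {a : V}
    (h : ∀ ε : ℝ, 0 < ε → ∃ z, IsDeepPoint F a a ε z) : ¬ IsStandardIFSAttractor (F a) := by
  rintro ⟨m, T, hT⟩
  obtain ⟨z₀, hz₀⟩ := h 1 one_pos
  have : Nonempty (Fin m) := ⟨(hT.exists_mem_cell (a := ()) hz₀.1).choose⟩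
  obtain ⟨j, hj⟩ := Finite.exists_min T.ratio
  obtain ⟨z, hz⟩ := h (T.ratio j / 2) (half_pos (T.ratio_pos j))
  obtain ⟨i, -, hi⟩ := hT.exists_mem_cell (a := ()) hz.1
  have hsub : T.map i '' F a ⊆ F a := hT.cell_subset i
  rw [T.map_eq_sim i] at hi hsub
  have := hz.2 _ _ (T.ratio_pos i) (T.ratio_lt_one i) hi hsub
  linarith [hj i, T.ratio_pos j]

/-! ### Vertex lists -/

theorem exists_src_eq_of_mem_vertexList :
    ∀ {p : List E} {x : V}, List.IsChain (fun e f => G.tgt e = G.src f) p → x ∈ G.vertexList p →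
      (G.vertexList p).getLast? = some x ∨ ∃ e ∈ p, G.src e = x
  | [], x, _, hx => by simp [vertexList] at hx
  | [e], x, _, hx => by
    simp only [vertexList, List.map_cons, List.map_nil, List.mem_cons, List.not_mem_nil,
      or_false] at hx
    rcases hx with rfl | rfl
    · exact Or.inr ⟨e, by simp, rfl⟩
    · exact Or.inl (by simp [vertexList])
  | e :: f :: p, x, hc, hx => by
    rw [List.isChain_cons_cons] at hc
    have hcons : G.vertexList (e :: f :: p) = G.src e :: G.vertexList (f :: p) := by
      simp [vertexList, hc.1]
    rw [hcons, List.mem_cons] at hx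
    rcases hx with rfl | hx
    · exact Or.inr ⟨e, by simp, rfl⟩
    · rcases exists_src_eq_of_mem_vertexList hc.2 hx with h | ⟨g, hg, h⟩
      · left
        rw [hcons]
        simpa [vertexList, List.getLast?_cons_cons] using h
      · exact Or.inr ⟨g, List.mem_cons_of_mem _ hg, h⟩

theorem tgt_mem_tail_vertexList {p : List E} {e : E} (he : e ∈ p) :
    G.tgt e ∈ (G.vertexList p).tail := by
  cases p with
  | nil => simp at he
  | cons f p => exact List.mem_map_of_mem he

theorem IsPathFromTo.exists_edge {p : List E} {a b : V} (h : G.IsPathFromTo p a b) :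
    ∃ e ∈ p, G.src e = a := by
  obtain ⟨⟨hne, -⟩, h1, -⟩ := h
  cases p with
  | nil => exact absurd rfl hne
  | cons e p => exact ⟨e, by simp, by simpa [vertexList] using h1⟩

theorem IsSimplePathFromTo.tgt_ne {p : List E} {a b : V} (h : G.IsSimplePathFromTo p a b) {e : E}
    (he : e ∈ p) : G.tgt e ≠ a := by
  obtain ⟨⟨⟨hne, -⟩, h1, -⟩, hnd⟩ := h
  have ht := G.tgt_mem_tail_vertexList he
  cases p with
  | nil => exact absurd rfl hne
  | cons f p =>
    simp only [vertexList, List.head?_cons, Option.some.injEq] at h1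
    simp only [vertexList, List.nodup_cons] at hnd
    rintro rfl
    exact hnd.1 (h1 ▸ ht)

/-- Every vertex of a closed path has an edge of the path leaving it. -/
theorem IsPathFromTo.exists_src_eq_of_closed {c : List E} {b x : V} (h : G.IsPathFromTo c b b)
    (hx : x ∈ G.vertexList c) : ∃ e ∈ c, G.src e = x := by
  rcases exists_src_eq_of_mem_vertexList h.1.2 hx with hl | he
  · rw [h.2.2, Option.some.injEq] at hl
    exact hl ▸ h.exists_edge
  · exact he

/-! ### Bounds for the dimension -/

/-- Dimension zero is excluded by counting: `F a` contains both `0` and `1`. -/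
theorem dim_pos_of_hausdorffMeasure_eq_one {s : ℝ≥0} {a : V} (hunit : OnUnitInterval F)
    (ha : μH[(s : ℝ)] (F a) = 1) : 0 < (s : ℝ) := by
  refine lt_of_le_of_ne s.2 fun h => ?_
  rw [← h] at ha
  have h2 : μH[(0 : ℝ)] ({0, 1} : Set ℝ) = 2 := by
    rw [Set.insert_eq, measure_union (by simp) (measurableSet_singleton _),
      Measure.hausdorffMeasure_zero_singleton, Measure.hausdorffMeasure_zero_singleton]
    norm_num
  have := measure_mono (μ := μH[(0 : ℝ)]) (hunit a).1
  rw [h2, ha] at this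
  norm_num at this

/-- A totally filled unit interval would be a disjoint union of at least two closed cells. -/
theorem CSSC.ne_Icc [Finite E] (hcssc : G.CSSC F) (hF : G.IsAttractor F)
    (hunit : OnUnitInterval F) (hout : G.TwoEdgesLeaving) (a : V) : F a ≠ Set.Icc 0 1 := by
  intro h
  obtain ⟨e, f, hef, rfl, hfe⟩ := hout a
  have hpre : IsPreconnected (F (G.src e)) := h ▸ isPreconnected_Icc
  have hclosed : ∀ g, IsClosed (G.map g '' F (G.tgt g)) := fun g =>
    ((hF.1 _).2.image (G.continuous_map g)).isClosed
  have hne : ∀ g, (G.map g '' F (G.tgt g)).Nonempty := fun g => (hF.1 _).1.image _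
  obtain ⟨y, hy⟩ := hne f
  obtain ⟨x, hx⟩ := hne e
  obtain ⟨z, -, hze, hzo⟩ := isPreconnected_closed_iff.1 hpre (G.map e '' F (G.tgt e))
    (⋃ g ∈ {g | g ≠ e ∧ G.src g = G.src e}, G.map g '' F (G.tgt g)) (hclosed e)
    ((Set.toFinite _).isClosed_biUnion fun g _ => hclosed g)
    (fun q hq => by
      obtain ⟨g, hg, hqg⟩ := hF.exists_mem_cell hq
      by_cases hge : g = e
      · exact Or.inl (hge ▸ hqg)
      · exact Or.inr (Set.mem_biUnion (x := g) ⟨hge, hg⟩ hqg))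
    ⟨x, hF.cell_subset e hx, hx⟩
    ⟨y, hfe ▸ hF.cell_subset f hy, Set.mem_biUnion (x := f) ⟨hef.symm, hfe⟩ hy⟩
  simp only [Set.mem_iUnion, exists_prop] at hzo
  obtain ⟨g, ⟨hge, hg⟩, hz⟩ := hzo
  exact hge (hcssc.eq_of_mem hunit hg (cell_subset_image_Icc hunit g hz)
    (cell_subset_image_Icc hunit e hze))

/-- A compact subset of `[0, 1]` of full length is all of `[0, 1]`, which the attractor is not. -/
theorem CSSC.dim_lt_one [Finite E] (hcssc : G.CSSC F) (hF : G.IsAttractor F)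
    (hunit : OnUnitInterval F) (hout : G.TwoEdgesLeaving) {s : ℝ} {a : V}
    (ha : μH[s] (F a) = 1) : s < 1 := by
  by_contra! hs
  refine hcssc.ne_Icc hF hunit hout a ((hunit a).2.antisymm fun y hy => ?_)
  by_contra hyF
  have hvol : 1 ≤ volume (F a) := by
    rw [← hausdorffMeasure_real, ← ha]
    exact Measure.hausdorffMeasure_mono hs _
  have hy0 : 0 < y := lt_of_le_of_ne hy.1 fun h => hyF (h ▸ (hunit a).1 (by simp))
  have hy1 : y < 1 := lt_of_le_of_ne hy.2 fun h => hyF (h ▸ (hunit a).1 (by simp))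
  have hopen : IsOpen ((F a)ᶜ ∩ Set.Ioo 0 1) := (hF.1 a).2.isClosed.isOpen_compl.inter isOpen_Ioo
  have hpos : 0 < volume ((F a)ᶜ ∩ Set.Ioo (0 : ℝ) 1) :=
    hopen.measure_pos volume ⟨y, hyF, hy0, hy1⟩
  have hle : volume (F a) + volume ((F a)ᶜ ∩ Set.Ioo (0 : ℝ) 1) ≤ 1 := by
    rw [← measure_union (Set.disjoint_left.2 fun z hz hz' => hz'.1 hz) hopen.measurableSet]
    refine (measure_mono (Set.union_subset (hunit a).2
      (Set.inter_subset_right.trans Set.Ioo_subset_Icc_self))).trans_eq ?_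
    simp
  have : (1 : ℝ≥0∞) < 1 := calc
    (1 : ℝ≥0∞) = 1 + 0 := (add_zero _).symm
    _ < 1 + volume ((F a)ᶜ ∩ Set.Ioo (0 : ℝ) 1) := ENNReal.add_lt_add_left (by simp) hpos
    _ ≤ volume (F a) + volume ((F a)ᶜ ∩ Set.Ioo (0 : ℝ) 1) := by gcongr
    _ ≤ 1 := hle
  exact lt_irrefl _ this

end GraphIFS

open GraphIFS in
theorem mainTheorem3 {V : Type u} {E : Type v} [Fintype V] [Fintype E]
    (hn : 2 ≤ Fintype.card V)
    (G : GraphIFS V E) (hconn : G.StronglyConnected) (hout : G.TwoEdgesLeaving)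
    (F : V → Set ℝ) (hF : G.IsAttractor F) (hunit : OnUnitInterval F) (hcssc : G.CSSC F)
    (hmin : G.HasMinimalEdges F)
    (a : V) (s : ℝ≥0) (hs : dimH (F a) = (s : ℝ≥0∞))
    (w : V) (hw : w ≠ a)
    (c : List E) (hc : G.IsSimpleCycle c)
    (hwc : w ∈ G.vertexList c) (hac : a ∉ G.vertexList c)
    (p : List E) (hp : G.IsSimplePathFromTo p a w)
    (V' : Set V) (hV' : V' = {x | x ∈ G.vertexList p ∨ x ∈ G.vertexList c})
    (hHa : μH[(s : ℝ)] (F a) = 1)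
    (hHe : ∀ x ∈ V', ∀ e : E, G.src e = x → μH[(s : ℝ)] (F (G.tgt e)) = 1)
    (hsub : ∀ x ∈ V' \ {a}, ¬ F a ⊆ F x) :
    ¬ IsStandardIFSAttractor (F a) := by
  have hs0 : 0 < (s : ℝ) := dim_pos_of_hausdorffMeasure_eq_one hunit hHa
  have hs1 : (s : ℝ) < 1 := hcssc.dim_lt_one hF hunit hout hHa
  have hcell : ∀ x ∈ V', ∀ t b : ℝ, 0 < t → t < 1 → sim t b '' F a ⊆ F x →
      ∃ g, G.src g = x ∧ Set.Icc b (b + t) ⊆ G.map g '' Set.Icc 0 1 :=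
    fun x hx t b ht0 ht1 hT => hmin.exists_Icc_subset hconn hF hunit hcssc hs0 hs1 hHa
      (hHe x hx) ht0 ht1 hT
  have hpV : ∀ e ∈ p, G.tgt e ∈ V' \ {a} := fun e he =>
    ⟨hV' ▸ Or.inl (List.mem_of_mem_tail (tgt_mem_tail_vertexList he)), hp.tgt_ne he⟩
  have hcV : ∀ e ∈ c, G.tgt e ∈ V' \ {a} := fun e he => by
    have h := List.mem_of_mem_tail (G.tgt_mem_tail_vertexList he)
    exact ⟨hV' ▸ Or.inr h, fun h' => hac (h' ▸ h)⟩
  obtain ⟨⟨b, hcb⟩, -⟩ := hc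
  have hW : ∀ x ∈ V' \ {a}, ∃ e, G.src e = x ∧ G.tgt e ∈ V' \ {a} := by
    have hcyc : ∀ x ∈ G.vertexList c, ∃ e, G.src e = x ∧ G.tgt e ∈ V' \ {a} := fun x hx => by
      obtain ⟨e, he, rfl⟩ := hcb.exists_src_eq_of_closed hx
      exact ⟨e, rfl, hcV e he⟩
    rintro x ⟨hx, -⟩
    rw [hV'] at hx
    rcases hx with hx | hx
    · rcases exists_src_eq_of_mem_vertexList hp.1.1.2 hx with h | ⟨e, he, rfl⟩
      · rw [hp.1.2.2, Option.some.injEq] at h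
        exact hcyc x (h ▸ hwc)
      · exact ⟨e, rfl, hpV e he⟩
    · exact hcyc x hx
  -- The vertex `a` is not in `V' \ {a}`; the first edge of `p` leads from it into this set.
  obtain ⟨e, he, rfl⟩ := hp.1.exists_edge
  have haV : G.src e ∈ V' := hV' ▸ Or.inl (List.mem_of_mem_head? hp.1.2.1)
  refine not_isStandardIFSAttractor_of_isDeepPoint fun ε hε => ?_
  obtain ⟨z, hz⟩ := exists_isDeepPoint hF hunit hcssc hW (fun x hx => hcell x hx.1) hsub hε
    (hpV e he)
  have h := hz.map hF hunit hcssc (hcell _ haV) (hsub _ (hpV e he))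
  refine ⟨_, h.1, fun t b h0 h1 h2 h3 => (h.2 t b h0 h1 h2 h3).trans ?_⟩
  exact mul_le_of_le_one_left hε.le (G.ratio_lt_one e).le
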